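/- **Theorem.** Let $n\ge 2$ be an integer and $0<\lambda<1$. Let $\psi\colon(0,\infty)\to(0,\infty)$ be a decreasing function, and let $g\colon(0,\infty)\to(0,\infty)$ be a continuous increasing function such that $g(q)\to 0$ as $q\to 0$, the function $q\mapsto g(q)/q$ is decreasing, and $g(q)/q\to\infty$ as $q\to 0$. (Monotonicity is understood in the weak sense.) For $P\in\mathbb Z[X]$ let $H(P)$ be the height of $P$, i.e. the maximum absolute value of its coefficients, and let $D(P)$ be its discriminant. For $\kappa>0$ let $\mathcal A_n^{\lambda}(\psi;\kappa)$ be the set of all $x\in\mathbb R$ such that $|P(x)|\le\psi(H(P))$ for infinitely many polynomials $P\in\mathbb Z[X]$ with $\deg P\le n$ and $|D(P)|\ge\kappa\,H(P)^{2(n-1-\lambda)}$. If $$\sum_{q=1}^{\infty} g\!\left(\frac{\psi(q)}{q}\right)q^{n}<\infty,$$ then $\mathcal H^g\big(\mathcal A_n^{\lambda}(\psi;\kappa)\big)=0$ for every $\kappa>0$. Here $\mathcal H^g$ denotes the Hausdorff $g$-measure $$\mathcal H^g(A)=\sup_{\rho>0}\ \inf\Big\{\sum_i g(r_i)\Big\},$$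 where the infimum is over all finite or countable covers of $A$ by balls (open intervals) of radii $r_i\in(0,\rho]$. -/

import Mathlib

open scoped ENNReal Topology Polynomial
open Set Filter

/-- An approximation function: a (weakly) decreasing function from the positive reals to the
positive reals. Values outside `(0, ∞)` are irrelevant. -/
structure IsApproximationFunction (ψ : ℝ → ℝ) : Prop where
  pos : ∀ r, 0 < r → 0 < ψ r
  antitone : AntitoneOn ψ (Ioi 0)

/-- A dimension function: a continuous, (weakly) increasing function from the positive reals to the
positive reals which tends to `0` at `0`. Values outside `(0, ∞)` are irrelevant. -/
structure IsDimensionFunction (g : ℝ → ℝ) : Prop where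
  pos : ∀ r, 0 < r → 0 < g r
  continuous : ContinuousOn g (Ioi 0)
  monotone : MonotoneOn g (Ioi 0)
  tendsto_zero : Tendsto g (𝓝[>] 0) (𝓝 0)

/-- The family of balls `B(c i, r i)`, with `i` running over the (finite or countably infinite)
index set `I`, is a `ρ`-cover of `A`: all radii lie in `(0, ρ]` and the balls cover `A`. -/
def IsBallCover (ρ : ℝ) (A : Set ℝ) (I : Set ℕ) (c r : ℕ → ℝ) : Prop :=
  (∀ i ∈ I, 0 < r i ∧ r i ≤ ρ) ∧ A ⊆ ⋃ i ∈ I, Metric.ball (c i) (r i)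

/-- The infimum of `∑ g (radius)` over all `ρ`-covers of `A` by balls. -/
noncomputable def hausdorffPremeasure (g : ℝ → ℝ) (ρ : ℝ) (A : Set ℝ) : ℝ≥0∞ :=
  ⨅ (I : Set ℕ) (c : ℕ → ℝ) (r : ℕ → ℝ) (_ : IsBallCover ρ A I c r),
    ∑' i : I, ENNReal.ofReal (g (r i))

/-- The Hausdorff `g`-measure of a set of reals. -/
noncomputable def hausdorffGMeasure (g : ℝ → ℝ) (A : Set ℝ) : ℝ≥0∞ :=
  ⨆ (ρ : ℝ) (_ : 0 < ρ), hausdorffPremeasure g ρ A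

/-- Integer polynomials `P` of degree at most `n` with `|D(P)| ≥ κ * H(P) ^ (2 * (n - 1 - lam))`.
Here `D(P)` is the discriminant, and the height `H(P)`, the maximum absolute value of the
coefficients, is `P.supNorm`. -/
def largeDiscrPolys (n : ℕ) (lam κ : ℝ) : Set ℤ[X] :=
  {P | P.natDegree ≤ n ∧ κ * P.supNorm ^ (2 * ((n : ℝ) - 1 - lam)) ≤ |(P.discr : ℝ)|}

/-- The real numbers `x` such that `|P(x)| ≤ ψ(H(P))` for infinitely many `P` in
`largeDiscrPolys n lam κ`. -/
def approxSet (n : ℕ) (lam κ : ℝ) (ψ : ℝ → ℝ) : Set ℝ :=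
  {x | {P : ℤ[X] | P ∈ largeDiscrPolys n lam κ ∧
    |Polynomial.aeval x P| ≤ ψ P.supNorm}.Infinite}

/-! This is a Borel–Cantelli argument over dyadic ranges of the height `H`, on each `[-R, R]`.

A large discriminant forces a large derivative. Convergence and `g q / q → ∞` give `ψ (2 ^ t) * 2 ^
t → 0`, so `|P(x)| * H` is small for tall `P`. If also `|P'(x)| < 1`, then `P(x + ·)`, which has the
same discriminant, has constant term `≪ 1 / H` and linear term at most `1`. Expanding the Sylvester
determinant gives `|D(P)| ≪ H ^ (2n - 4)`, which contradicts the lower bound as `λ < 1`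
(`abs_discr_le_of_small_at`).

It remains to cover the points where `|P(x)| ≤ δ` and `|P'(x)| ≥ 1`, for heights at most `X`. The
constant coefficient is left free: for each of the `≪ X ^ n` choices `f` of the others, `f(x)` must
be `δ`-close to an integer. Split `[-R, R]` into intervals `I` where `|f'| ∈ [2 ^ k, 2 ^ (k + 1))`,
boundedly many for each `k`. On `I` about `2 ^ k |I| + 1` integers occur, each costing one ball of
radius `≍ δ / 2 ^ k`. As `g q / q` decreases and `2 ^ k ≪ X`, the cost of `I` is `≪ (|I| + 2 ^ (-k))
X g(δ / X)`, which sums over all `I` to `≪ X g(δ / X)`. The total `X ^ (n + 1) g(δ / X)`, with `X =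
2 ^ (t + 1)` and `δ = ψ (2 ^ t)`, is summable by condensation of the given series. -/

/-! ### The Hausdorff premeasure as an outer measure. -/

theorem hausdorffPremeasure_le_tsum {ι : Type*} [Countable ι] {g : ℝ → ℝ} {ρ : ℝ} {A : Set ℝ}
    (c r : ι → ℝ) (hr : ∀ i, 0 < r i ∧ r i ≤ ρ) (hA : A ⊆ ⋃ i, Metric.ball (c i) (r i)) :
    hausdorffPremeasure g ρ A ≤ ∑' i, ENNReal.ofReal (g (r i)) := by
  obtain ⟨e, he⟩ := exists_injective_nat ι
  have key : IsBallCover ρ A (range e) (Function.extend e c 0) (Function.extend e r 0) := by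
    refine ⟨?_, ?_⟩
    · rintro _ ⟨i, rfl⟩
      simpa [he.extend_apply] using hr i
    · simpa [he.extend_apply] using hA
  refine (iInf₂_le_of_le (range e) (Function.extend e c 0)
    (iInf₂_le (Function.extend e r 0) key)).trans (le_of_eq ?_)
  rw [tsum_range (fun m => ENNReal.ofReal (g (Function.extend e r 0 m))) he]
  simp [he.extend_apply]

theorem exists_isBallCover_tsum_le {g : ℝ → ℝ} {ρ : ℝ} {A : Set ℝ}
    (hA : hausdorffPremeasure g ρ A ≠ ∞) {ε : ℝ≥0∞} (hε : ε ≠ 0) :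
    ∃ (I : Set ℕ) (c r : ℕ → ℝ), IsBallCover ρ A I c r ∧
      ∑' i : I, ENNReal.ofReal (g (r i)) ≤ hausdorffPremeasure g ρ A + ε := by
  have h : hausdorffPremeasure g ρ A < hausdorffPremeasure g ρ A + ε :=
    ENNReal.lt_add_right hA hε
  conv_lhs at h => rw [hausdorffPremeasure]
  simp only [iInf_lt_iff] at h
  obtain ⟨I, c, r, hI, hlt⟩ := h
  exact ⟨I, c, r, hI, hlt.le⟩

theorem hausdorffPremeasure_mono {g : ℝ → ℝ} {ρ : ℝ} {A B : Set ℝ} (h : A ⊆ B) :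
    hausdorffPremeasure g ρ A ≤ hausdorffPremeasure g ρ B :=
  iInf_mono fun _ => iInf_mono fun _ => iInf_mono fun _ =>
    iInf_mono' fun hB => ⟨⟨hB.1, h.trans hB.2⟩, le_rfl⟩

theorem hausdorffPremeasure_iUnion_nat_le {g : ℝ → ℝ} {ρ : ℝ} (A : ℕ → Set ℝ) :
    hausdorffPremeasure g ρ (⋃ i, A i) ≤ ∑' i, hausdorffPremeasure g ρ (A i) := by
  by_cases htop : ∑' i, hausdorffPremeasure g ρ (A i) = ∞
  · simp [htop]
  refine ENNReal.le_of_forall_pos_le_add fun ε hε _ => ?_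
  obtain ⟨δ, hδ, hsum⟩ := ENNReal.exists_pos_sum_of_countable
    (ENNReal.coe_ne_zero.2 hε.ne') ℕ
  choose I c r hcov hle using fun i =>
    exists_isBallCover_tsum_le (ENNReal.ne_top_of_tsum_ne_top htop i)
      (ENNReal.coe_ne_zero.2 (hδ i).ne')
  calc hausdorffPremeasure g ρ (⋃ i, A i)
      ≤ ∑' p : Σ i, I i, ENNReal.ofReal (g (r p.1 p.2)) := by
        refine hausdorffPremeasure_le_tsum (ι := Σ i, I i) (fun p => c p.1 p.2)
          (fun p => r p.1 p.2) (fun p => (hcov p.1).1 _ p.2.2) ?_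
        refine iUnion_subset fun i x hx => ?_
        obtain ⟨m, hm, hxm⟩ := mem_iUnion₂.1 ((hcov i).2 hx)
        exact mem_iUnion.2 ⟨⟨i, m, hm⟩, hxm⟩
    _ = ∑' i, ∑' m : I i, ENNReal.ofReal (g (r i m)) := ENNReal.tsum_sigma' _
    _ ≤ ∑' i, (hausdorffPremeasure g ρ (A i) + δ i) := ENNReal.tsum_le_tsum hle
    _ = ∑' i, hausdorffPremeasure g ρ (A i) + ∑' i, (δ i : ℝ≥0∞) := ENNReal.tsum_add
    _ ≤ ∑' i, hausdorffPremeasure g ρ (A i) + ε := by gcongr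

/-- The premeasure `hausdorffPremeasure g ρ` as an outer measure. -/
noncomputable def hausdorffPreOuterMeasure (g : ℝ → ℝ) (ρ : ℝ) : MeasureTheory.OuterMeasure ℝ where
  measureOf := hausdorffPremeasure g ρ
  empty := by
    have := hausdorffPremeasure_le_tsum (ι := Empty) (g := g) (ρ := ρ) (A := ∅)
      Empty.elim Empty.elim (fun i => i.elim) (by simp)
    simpa using this
  mono := hausdorffPremeasure_mono
  iUnion_nat A _ := hausdorffPremeasure_iUnion_nat_le A

theorem hausdorffPreOuterMeasure_le_of_subset_ball {g : ℝ → ℝ} {ρ : ℝ} {A : Set ℝ} {c r : ℝ}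
    (hr : 0 < r) (hrρ : r ≤ ρ) (hA : A ⊆ Metric.ball c r) :
    hausdorffPreOuterMeasure g ρ A ≤ ENNReal.ofReal (g r) := by
  have := hausdorffPremeasure_le_tsum (ι := Unit) (g := g) (ρ := ρ) (A := A)
      (fun _ => c) (fun _ => r) (fun _ => ⟨hr, hrρ⟩) (by rwa [iUnion_const])
  rw [tsum_fintype, Fintype.sum_unique] at this
  exact this

theorem hausdorffGMeasure_eq_zero_of_forall {g : ℝ → ℝ} {A : Set ℝ}
    (h : ∀ ρ, 0 < ρ → hausdorffPreOuterMeasure g ρ A = 0) : hausdorffGMeasure g A = 0 := by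
  simp only [hausdorffGMeasure, ENNReal.iSup_eq_zero]
  exact h

/-! ### Discriminants and the Sylvester determinant. -/

namespace Polynomial

/-- Resultants commute with `φ`, injectivity preserves the degree, and the nonzero leading
coefficient cancels from the relation between discriminant and resultant of `f` and `f'`. -/
theorem map_discr {R S : Type*} [CommRing R] [CommRing S] [IsDomain S] (φ : R →+* S)
    (hφ : Function.Injective φ) {f : R[X]} (hf : 0 < f.degree) :
    (f.map φ).discr = φ f.discr := by
  have hf' : 0 < (f.map φ).degree := by rwa [degree_map_eq_of_injective hφ]
  have h1 := congrArg φ (resultant_deriv hf)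
  have h2 := resultant_deriv hf'
  rw [derivative_map, natDegree_map_eq_of_injective hφ, resultant_map_map, h1,
    leadingCoeff_map_of_injective hφ] at h2
  simp only [map_mul, map_pow, map_neg, map_one] at h2
  have h3 : φ f.leadingCoeff ≠ 0 := by
    rw [← leadingCoeff_map_of_injective hφ, leadingCoeff_ne_zero]
    exact ne_zero_of_degree_gt hf'
  have h4 : (-1 : S) ^ (f.natDegree * (f.natDegree - 1) / 2) ≠ 0 :=
    pow_ne_zero _ (neg_ne_zero.2 one_ne_zero)
  exact (mul_left_cancel₀ (mul_ne_zero h4 h3) h2).symm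

theorem discr_taylor {K : Type*} [Field K] [CharZero K] {f : K[X]} (hf : 0 < f.degree) (x : K) :
    (taylor x f).discr = f.discr := by
  have hnd : 0 < f.natDegree := natDegree_pos_iff_degree_pos.2 hf
  have hf' : 0 < (taylor x f).degree := by rwa [degree_taylor]
  have h1 := resultant_deriv hf
  have h2 := resultant_deriv hf'
  have h5 : derivative (taylor x f) = taylor x (derivative f) := by
    simp [taylor_apply, derivative_comp]
  have h6 := resultant_taylor f (derivative f) x
  simp only [natDegree_taylor, natDegree_derivative] at h6
  rw [natDegree_taylor, h5, h6, h1, leadingCoeff_taylor] at h2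
  have h3 : f.leadingCoeff ≠ 0 := leadingCoeff_ne_zero.2 (ne_zero_of_degree_gt hf)
  have h4 : (-1 : K) ^ (f.natDegree * (f.natDegree - 1) / 2) ≠ 0 :=
    pow_ne_zero _ (neg_ne_zero.2 one_ne_zero)
  exact (mul_left_cancel₀ (mul_ne_zero h4 h3) h2).symm

/-- The entries of the modified Sylvester matrix in all rows but the last. -/
theorem sylvesterDeriv_apply {R : Type*} [CommRing R] {f : R[X]} (hf : f.natDegree ≠ 0)
    (i j : Fin (f.natDegree - 1 + f.natDegree)) (hi : (i : ℕ) ≠ 2 * f.natDegree - 2) :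
    sylvesterDeriv f i j = if (j : ℕ) < f.natDegree - 1 then
        (if (j : ℕ) ≤ i ∧ (i : ℕ) ≤ j + f.natDegree then f.coeff (i - j) else 0)
      else (if (j : ℕ) - (f.natDegree - 1) ≤ i ∧ (i : ℕ) ≤ j then
        f.coeff (i - (j - (f.natDegree - 1)) + 1) * ((i - (j - (f.natDegree - 1)) : ℕ) + 1)
        else 0) := by
  rw [sylvesterDeriv, dif_neg hf, Matrix.updateRow_ne (Fin.ne_of_val_ne hi)]
  induction j using Fin.addCases with
  | left j => simp [sylvester]
  | right j =>
    simp only [sylvester, Matrix.of_apply, Fin.addCases_right, Fin.val_natAdd, coeff_derivative,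
      mem_Icc]
    rw [if_neg (c := f.natDegree - 1 + (j : ℕ) < f.natDegree - 1) (by lia)]
    simp only [Nat.add_comm (f.natDegree - 1), Nat.add_sub_cancel]

theorem sylvesterDeriv_apply_last {R : Type*} [CommRing R] {f : R[X]} (hf : f.natDegree ≠ 0)
    (i j : Fin (f.natDegree - 1 + f.natDegree)) (hi : (i : ℕ) = 2 * f.natDegree - 2) :
    sylvesterDeriv f i j = if (j : ℕ) = f.natDegree - 2 then 1
      else if (j : ℕ) = 2 * f.natDegree - 2 then (f.natDegree : R) else 0 := by
  rw [sylvesterDeriv, dif_neg hf, show i = ⟨2 * f.natDegree - 2, by lia⟩ from Fin.ext hi,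
    Matrix.updateRow_self]

theorem abs_sylvesterDeriv_last_le {f : ℝ[X]} (hf : f.natDegree ≠ 0)
    (i j : Fin (f.natDegree - 1 + f.natDegree)) (hi : (i : ℕ) = 2 * f.natDegree - 2) :
    |sylvesterDeriv f i j| ≤ f.natDegree := by
  have h1 : (1 : ℝ) ≤ f.natDegree := by exact_mod_cast Nat.one_le_iff_ne_zero.2 hf
  rw [sylvesterDeriv_apply_last hf i j hi]
  split_ifs <;> simp [h1]

theorem abs_sylvesterDeriv_le {f : ℝ[X]} {h : ℝ} (hf : f.natDegree ≠ 0)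
    (hc : ∀ i, |f.coeff i| ≤ h) (i j : Fin (f.natDegree - 1 + f.natDegree))
    (hi : (i : ℕ) ≠ 2 * f.natDegree - 2) :
    |sylvesterDeriv f i j| ≤ f.natDegree * h := by
  have h0 : 0 ≤ h := (abs_nonneg _).trans (hc 0)
  have h1 : (1 : ℝ) ≤ f.natDegree := by exact_mod_cast Nat.one_le_iff_ne_zero.2 hf
  rw [sylvesterDeriv_apply hf i j hi]
  split_ifs with h2 h3 h3
  · nlinarith [hc (i - j)]
  · simpa using by positivity
  · rw [abs_mul, mul_comm]
    have : ((i - (j - (f.natDegree - 1)) : ℕ) : ℝ) + 1 ≤ f.natDegree := by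
      exact_mod_cast (by lia : (i - (j - (f.natDegree - 1)) : ℕ) + 1 ≤ f.natDegree)
    rw [abs_of_nonneg (a := ((i - (j - (f.natDegree - 1)) : ℕ) : ℝ) + 1) (by positivity)]
    gcongr
    exact hc _
  · simpa using by positivity

/-- The source of the saving of `h ^ 2`. Row `0` contains only `f.coeff 0` (column `0`) and `f.coeff
1` (column `deg f - 1`). The first is small enough to absorb any entry of row `1`. With the second,
column `deg f - 1` is used up, and with it the only entry of row `1` that can be large, `2 * f.coeff
2`. -/
theorem abs_sylvesterDeriv_zero_mul_one_le {f : ℝ[X]} {h : ℝ} (hf : 2 ≤ f.natDegree) (hh : 1 ≤ h)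
    (hc : ∀ i, |f.coeff i| ≤ h) (hc0 : |f.coeff 0| * h ≤ 1) (hc1 : |f.coeff 1| ≤ 1)
    (i₀ i₁ j₀ j₁ : Fin (f.natDegree - 1 + f.natDegree)) (hi₀ : (i₀ : ℕ) = 0) (hi₁ : (i₁ : ℕ) = 1)
    (hj : j₀ ≠ j₁) :
    |sylvesterDeriv f i₀ j₀ * sylvesterDeriv f i₁ j₁| ≤ f.natDegree := by
  have hk : (1 : ℝ) ≤ f.natDegree := by exact_mod_cast (by lia : 1 ≤ f.natDegree)
  have hj' : (j₀ : ℕ) ≠ j₁ := fun e => hj (Fin.ext e)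
  have hrow := abs_sylvesterDeriv_le (by lia) hc i₁ j₁ (by lia)
  have hc0' : |f.coeff 0| ≤ 1 := by nlinarith [abs_nonneg (f.coeff 0)]
  rw [abs_mul]
  rcases lt_or_ge (j₀ : ℕ) (f.natDegree - 1) with hlt | hge
  · rcases Nat.eq_zero_or_pos (j₀ : ℕ) with h0 | h0
    · have : sylvesterDeriv f i₀ j₀ = f.coeff 0 := by
        rw [sylvesterDeriv_apply (by lia) _ _ (by lia), if_pos hlt, if_pos (by lia), hi₀]
        simp
      rw [this]
      nlinarith [abs_nonneg (f.coeff 0)]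
    · have : sylvesterDeriv f i₀ j₀ = 0 := by
        rw [sylvesterDeriv_apply (by lia) _ _ (by lia), if_pos hlt, if_neg (by lia)]
      simp [this]
  · rcases hge.eq_or_lt with heq | hgt
    · have e₀ : sylvesterDeriv f i₀ j₀ = f.coeff 1 := by
        rw [sylvesterDeriv_apply (by lia) _ _ (by lia), if_neg (by lia), if_pos (by lia), hi₀]
        simp
      have e₁ : |sylvesterDeriv f i₁ j₁| ≤ 1 := by
        rw [sylvesterDeriv_apply (by lia) _ _ (by lia), hi₁]
        split_ifs with h2 h3 h3
        · rcases (by lia : (j₁ : ℕ) = 0 ∨ (j₁ : ℕ) = 1) with e | e <;> simpa [e]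
        · simp
        · simpa [show (j₁ : ℕ) = f.natDegree by lia,
            show f.natDegree - (f.natDegree - 1) = 1 by lia] using hc1
        · simp
      rw [e₀]
      nlinarith [abs_nonneg (f.coeff 1), abs_nonneg (sylvesterDeriv f i₁ j₁)]
    · have : sylvesterDeriv f i₀ j₀ = 0 := by
        rw [sylvesterDeriv_apply (by lia) _ _ (by lia), if_neg (by lia), if_neg (by lia)]
      simp [this]

/-- A real polynomial with bounded coefficients, whose linear coefficient is small and whose
constant coefficient is very small, has a small discriminant. -/
theorem abs_discr_le_of_abs_coeff_le {f : ℝ[X]} {h : ℝ} (hf : 2 ≤ f.natDegree) (hh : 1 ≤ h)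
    (hc : ∀ i, |f.coeff i| ≤ h) (hc0 : |f.coeff 0| * h ≤ 1) (hc1 : |f.coeff 1| ≤ 1) :
    |f.discr| ≤ (f.natDegree - 1 + f.natDegree).factorial *
      (f.natDegree * (f.natDegree * (f.natDegree * h) ^ (2 * f.natDegree - 4))) := by
  classical
  set k := f.natDegree with hk
  let i₀ : Fin (k - 1 + k) := ⟨0, by lia⟩
  let i₁ : Fin (k - 1 + k) := ⟨1, by lia⟩
  let l : Fin (k - 1 + k) := ⟨2 * k - 2, by lia⟩
  have h01 : i₀ ≠ i₁ := by simp [i₀, i₁]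
  let s : Finset (Fin (k - 1 + k)) := (Finset.univ.erase i₀).erase i₁
  have hs : s.card = 2 * k - 3 := by
    rw [Finset.card_erase_of_mem (by simp [h01.symm]), Finset.card_erase_of_mem (by simp)]
    simp
    lia
  have hl : l ∈ s := by
    simp only [s, Finset.mem_erase, Finset.mem_univ, and_true, ne_eq, Fin.ext_iff, l, i₀, i₁]
    lia
  -- Of the `2k - 1` rows, rows `0` and `1` jointly contribute `k`, the modified last row
  -- contributes `k`, and each of the other `2k - 4` contributes `k * h`.
  have hterm (σ : Equiv.Perm (Fin (k - 1 + k))) :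
      |∏ i, sylvesterDeriv f i (σ i)| ≤ k * (k * (k * h) ^ (2 * k - 4)) := by
    rw [← Finset.mul_prod_erase _ _ (Finset.mem_univ i₀),
      ← Finset.mul_prod_erase _ _ (show i₁ ∈ Finset.univ.erase i₀ by simp [h01.symm]),
      ← mul_assoc, abs_mul]
    gcongr
    · exact abs_sylvesterDeriv_zero_mul_one_le hf hh hc hc0 hc1 _ _ _ _ rfl rfl
        (σ.injective.ne h01)
    · rw [← Finset.mul_prod_erase _ _ hl, abs_mul, Finset.abs_prod]
      gcongr
      · exact abs_sylvesterDeriv_last_le (by lia) _ _ rfl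
      · calc ∏ i ∈ s.erase l, |sylvesterDeriv f i (σ i)| ≤ ∏ _i ∈ s.erase l, (k * h) := by
              refine Finset.prod_le_prod (fun _ _ => abs_nonneg _) fun i hi => ?_
              exact abs_sylvesterDeriv_le (by lia) hc _ _
                fun e => (Finset.mem_erase.1 hi).1 (Fin.ext e)
          _ = (k * h) ^ (2 * k - 4) := by
              rw [Finset.prod_const, Finset.card_erase_of_mem hl, hs]
              congr 1
  rw [discr, abs_mul, abs_pow, abs_neg, abs_one, one_pow, mul_one, ← Matrix.det_transpose,
    Matrix.det_apply']
  refine (Finset.abs_sum_le_sum_abs _ _).trans ((Finset.sum_le_card_nsmul _ _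
    (k * (k * (k * h) ^ (2 * k - 4))) fun σ _ => ?_).trans_eq ?_)
  · rw [abs_mul]
    have : |((Equiv.Perm.sign σ : ℤ) : ℝ)| = 1 := by
      rcases Int.units_eq_one_or (Equiv.Perm.sign σ) with e | e <;> simp [e]
    rw [this, one_mul]
    exact hterm σ
  · rw [Finset.card_univ, Fintype.card_perm, Fintype.card_fin, nsmul_eq_mul]

end Polynomial

/-! ### Small value and small derivative force a small discriminant. -/

namespace Polynomial

theorem abs_eval_le_of_abs_coeff_le {f : ℝ[X]} {n : ℕ} {h R x : ℝ} (hn : f.natDegree ≤ n)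
    (hc : ∀ i, |f.coeff i| ≤ h) (hR : 1 ≤ R) (hx : |x| ≤ R) :
    |f.eval x| ≤ (n + 1) * R ^ n * h := by
  have h0 : 0 ≤ h := (abs_nonneg _).trans (hc 0)
  rw [eval_eq_sum_range' (Nat.lt_succ_of_le hn)]
  refine (Finset.abs_sum_le_sum_abs _ _).trans ((Finset.sum_le_card_nsmul _ _
    (h * R ^ n) fun i hi => ?_).trans_eq ?_)
  · rw [abs_mul, abs_pow]
    gcongr
    · exact hc i
    · exact (pow_le_pow_left₀ (abs_nonneg x) hx i).trans
        (pow_le_pow_right₀ hR (Nat.lt_succ_iff.1 (Finset.mem_range.1 hi)))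
  · rw [Finset.card_range, nsmul_eq_mul]
    push_cast
    ring

theorem abs_coeff_taylor_le {f : ℝ[X]} {n : ℕ} {h R x : ℝ} (hn : f.natDegree ≤ n)
    (hc : ∀ i, |f.coeff i| ≤ h) (hR : 1 ≤ R) (hx : |x| ≤ R) (i : ℕ) :
    |(taylor x f).coeff i| ≤ (n + 1) * R ^ n * (2 ^ n * h) := by
  have h0 : 0 ≤ h := (abs_nonneg _).trans (hc 0)
  rw [taylor_coeff]
  refine abs_eval_le_of_abs_coeff_le ((natDegree_hasseDeriv_le f i).trans (by lia))
    (fun j => ?_) hR hx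
  rw [hasseDeriv_coeff]
  rcases lt_or_ge n (j + i) with hlt | hge
  · rw [coeff_eq_zero_of_natDegree_lt (hn.trans_lt hlt)]
    simpa using by positivity
  · rw [abs_mul, Nat.abs_cast]
    gcongr
    · exact_mod_cast ((Nat.choose_le_two_pow (j + i) i)).trans (Nat.pow_le_pow_right two_pos hge)
    · exact hc _

/-- Translating `x` to the origin keeps the discriminant, turns the value and derivative at `x` into
the two lowest coefficients, and enlarges the other coefficients by at most a constant factor. -/
theorem abs_discr_le_of_small_at {P : ℤ[X]} {n : ℕ} {R x : ℝ} (hn : 2 ≤ n)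
    (hP : P.natDegree ≤ n) (hH : 1 ≤ P.supNorm) (hR : 1 ≤ R) (hx : |x| ≤ R)
    (h0 : |aeval x P| * ((n + 1) * R ^ n * 2 ^ n * P.supNorm) ≤ 1)
    (h1 : |aeval x (derivative P)| ≤ 1) :
    |(P.discr : ℝ)| ≤ ((2 * n).factorial * (n * (n * (n * ((n + 1) * R ^ n * 2 ^ n)) ^ (2 * n - 4))))
      * P.supNorm ^ (2 * n - 4) := by
  have hB : (1 : ℝ) ≤ (n + 1) * R ^ n * 2 ^ n := by
    have h1 : (1 : ℝ) ≤ R ^ n := one_le_pow₀ hR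
    have h2 : (1 : ℝ) ≤ 2 ^ n := one_le_pow₀ one_le_two
    have h3 : (1 : ℝ) ≤ n + 1 := by linarith [Nat.cast_nonneg (α := ℝ) n]
    exact one_le_mul_of_one_le_of_one_le (one_le_mul_of_one_le_of_one_le h3 h1) h2
  set B : ℝ := (n + 1) * R ^ n * 2 ^ n with hBdef
  have hn1 : (1 : ℝ) ≤ n := by exact_mod_cast (by lia : 1 ≤ n)
  have hBH : 1 ≤ B * P.supNorm := one_le_mul_of_one_le_of_one_le hB hH
  have hf1 : (1 : ℝ) ≤ (2 * n).factorial := by exact_mod_cast Nat.factorial_pos _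
  rw [mul_assoc, mul_assoc, mul_assoc, ← mul_pow, mul_assoc]
  rcases lt_or_ge P.natDegree 2 with hlt | hge
  -- In degree `0` or `1` the discriminant is `1`, and every factor of the bound is at least `1`.
  · have hD : P.discr = 1 := by
      rcases Nat.eq_zero_or_pos P.natDegree with h | h
      · rw [eq_C_of_natDegree_eq_zero h, discr_C]
      · exact discr_of_degree_eq_one (by
          rw [degree_eq_natDegree (by rintro rfl; simp at h), show P.natDegree = 1 by lia]; rfl)
    rw [hD, Int.cast_one, abs_one]
    have : (1 : ℝ) ≤ (n * (B * P.supNorm)) ^ (2 * n - 4) :=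
      one_le_pow₀ (one_le_mul_of_one_le_of_one_le hn1 hBH)
    exact one_le_mul_of_one_le_of_one_le hf1 (one_le_mul_of_one_le_of_one_le hn1
      (one_le_mul_of_one_le_of_one_le hn1 this))
  · have hinj : Function.Injective (Int.castRingHom ℝ) := Int.cast_injective
    have hdeg : 0 < P.degree := natDegree_pos_iff_degree_pos.1 (by lia)
    set q : ℝ[X] := P.map (Int.castRingHom ℝ) with hq
    have hqn : q.natDegree = P.natDegree := natDegree_map_eq_of_injective hinj _
    have hqd : 0 < q.degree := natDegree_pos_iff_degree_pos.1 (by lia)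
    have hqc (i : ℕ) : |q.coeff i| ≤ P.supNorm := by
      rw [hq, coeff_map]
      simpa [Int.norm_eq_abs] using P.le_supNorm i
    have hD : (P.discr : ℝ) = (taylor x q).discr := by
      rw [discr_taylor hqd, hq, map_discr _ hinj hdeg]; rfl
    have he (Q : ℤ[X]) : (Q.map (Int.castRingHom ℝ)).eval x = aeval x Q := by
      rw [eval_map, aeval_def]; rfl
    rw [hD]
    refine (abs_discr_le_of_abs_coeff_le (h := B * P.supNorm) ?_ hBH (fun i => ?_) ?_ ?_).trans ?_
    · rw [natDegree_taylor]; lia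
    · exact (abs_coeff_taylor_le (hqn.trans_le hP) hqc hR hx i).trans_eq (by rw [hBdef]; ring)
    · rwa [taylor_coeff_zero, hq, he]
    · rwa [taylor_coeff_one, hq, derivative_map, he]
    · rw [natDegree_taylor, hqn]
      have hk : (P.natDegree : ℝ) ≤ n := by exact_mod_cast hP
      have hb : (P.natDegree * (B * P.supNorm)) ^ (2 * P.natDegree - 4) ≤
          (n * (B * P.supNorm)) ^ (2 * n - 4) :=
        (pow_le_pow_left₀ (by positivity) (by gcongr) _).trans
          (pow_le_pow_right₀ (one_le_mul_of_one_le_of_one_le hn1 hBH) (by lia))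
      have hfac : ((P.natDegree - 1 + P.natDegree).factorial : ℝ) ≤ (2 * n).factorial := by
        exact_mod_cast Nat.factorial_le (by lia)
      gcongr

end Polynomial

theorem exists_forall_one_le_abs_derivative_of_mem_largeDiscrPolys {n : ℕ} (hn : 2 ≤ n) {lam κ R : ℝ}
    (hlam1 : lam < 1) (hκ : 0 < κ) (hR : 1 ≤ R) :
    ∃ B H₀ : ℝ, 0 < B ∧ ∀ P ∈ largeDiscrPolys n lam κ, H₀ ≤ P.supNorm → ∀ x, |x| ≤ R →
      |Polynomial.aeval x P| * (B * P.supNorm) ≤ 1 →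
      1 ≤ |Polynomial.aeval x (Polynomial.derivative P)| := by
  set B : ℝ := (n + 1) * R ^ n * 2 ^ n with hB
  set C : ℝ := (2 * n).factorial * (n * (n * (n * B) ^ (2 * n - 4))) with hC
  have htend : Tendsto (fun H : ℝ => κ * H ^ (2 * (1 - lam))) atTop atTop :=
    (tendsto_rpow_atTop (by linarith)).const_mul_atTop hκ
  obtain ⟨H₁, hH₁⟩ := (htend.eventually_gt_atTop C).exists_forall_of_atTop
  refine ⟨B, max 1 H₁, by positivity, fun P hP hPH x hx h0 => ?_⟩
  by_contra! hlt
  have hH : 1 ≤ P.supNorm := (le_max_left _ _).trans hPH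
  have h1 := Polynomial.abs_discr_le_of_small_at hn hP.1 hH hR hx h0 hlt.le
  have h2 := hH₁ _ ((le_max_right _ _).trans hPH)
  have hpos : 0 < P.supNorm := by linarith
  -- The surplus exponent `2 * (1 - lam)` over `2n - 4` is positive, so it beats the constant `C`
  -- for large heights.
  have h3 : P.supNorm ^ (2 * ((n : ℝ) - 1 - lam)) =
      P.supNorm ^ (2 * (1 - lam)) * P.supNorm ^ (2 * n - 4) := by
    rw [← Real.rpow_natCast, ← Real.rpow_add hpos]
    congr 1
    rw [Nat.cast_sub (by lia)]
    push_cast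
    ring
  have h4 := hP.2
  rw [h3, ← mul_assoc] at h4
  have h5 : C * P.supNorm ^ (2 * n - 4) <
      κ * P.supNorm ^ (2 * (1 - lam)) * P.supNorm ^ (2 * n - 4) := by gcongr
  linarith

/-! ### Dyadic decomposition by the size of the derivative. -/

/-- The position of `x` relative to the finite set `Z`: a monotone step function of `x` which is
constant exactly on the points of `Z` and the open intervals between them. -/
noncomputable def positionIn (Z : Finset ℝ) (x : ℝ) : ℕ :=
  (Z.filter (· < x)).card + (Z.filter (· ≤ x)).card

theorem monotone_positionIn (Z : Finset ℝ) : Monotone (positionIn Z) := fun x y hxy => by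
  unfold positionIn
  gcongr

theorem positionIn_le (Z : Finset ℝ) (x : ℝ) : positionIn Z x ≤ 2 * Z.card := by
  have h1 := Z.card_filter_le (· < x)
  have h2 := Z.card_filter_le (· ≤ x)
  unfold positionIn
  lia

theorem notMem_of_positionIn_eq {Z : Finset ℝ} {x y z : ℝ} (hxy : x < y)
    (h : positionIn Z x = positionIn Z y) (hz : z ∈ Icc x y) : z ∉ Z := by
  intro hzZ
  have h1 : (Z.filter (· < x)) ⊆ Z.filter (· < y) :=
    Finset.monotone_filter_right _ fun _ _ hw => lt_trans hw hxy
  have h2 : (Z.filter (· < y)) ⊆ Z.filter (· ≤ y) :=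
    Finset.monotone_filter_right _ fun _ _ hw => le_of_lt hw
  have h3 : (Z.filter (· < x)) ⊆ Z.filter (· ≤ x) :=
    Finset.monotone_filter_right _ fun _ _ hw => le_of_lt hw
  have h4 : (Z.filter (· ≤ x)) ⊆ Z.filter (· < y) :=
    Finset.monotone_filter_right _ fun _ _ hw => lt_of_le_of_lt hw hxy
  have := Finset.card_le_card h1
  have := Finset.card_le_card h2
  have := Finset.card_le_card h3
  have := Finset.card_le_card h4
  unfold positionIn at h
  -- The sets `(· < x) ⊆ (· ≤ x) ⊆ (· < y) ⊆ (· ≤ y)` form a chain, and the first two cardinalities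
  -- have the same sum as the last two, so all four sets agree.
  have h5 := Finset.eq_of_subset_of_card_le (h1.trans h2) (by lia)
  have : z ∈ Z.filter (· ≤ y) := Finset.mem_filter.2 ⟨hzZ, hz.2⟩
  rw [← h5, Finset.mem_filter] at this
  exact this.2.not_ge hz.1

theorem Polynomial.eval_neg_iff_of_positionIn_eq {p : ℝ[X]} {Z : Finset ℝ}
    (hZ : p.roots.toFinset ⊆ Z) {x y : ℝ} (hxy : x ≤ y) (h : positionIn Z x = positionIn Z y) :
    p.eval x < 0 ↔ p.eval y < 0 := by
  rcases eq_or_ne p 0 with rfl | hp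
  · simp
  rcases hxy.eq_or_lt with rfl | hlt
  · rfl
  have hroot : ∀ z ∈ Icc x y, p.eval z ≠ 0 := fun z hz h0 =>
    notMem_of_positionIn_eq hlt h hz (hZ (by simp [hp, h0]))
  constructor
  · intro hx
    by_contra! hy
    obtain ⟨z, hz, hz0⟩ := intermediate_value_Icc hxy p.continuous.continuousOn ⟨hx.le, hy⟩
    exact hroot z hz hz0
  · intro hy
    by_contra! hx
    obtain ⟨z, hz, hz0⟩ := intermediate_value_Icc' hxy p.continuous.continuousOn ⟨hy.le, hx⟩
    exact hroot z hz hz0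

/-- The points where the derivative of `f` is equal to `± 2 ^ k` or to `± 2 ^ (k + 1)`, apart from
the case of a constant derivative. -/
noncomputable def derivLevelPoints (f : ℝ[X]) (k : ℕ) : Finset ℝ :=
  (f.derivative ^ 2 - Polynomial.C ((2 ^ k) ^ 2)).roots.toFinset ∪
    (f.derivative ^ 2 - Polynomial.C ((2 ^ (k + 1)) ^ 2)).roots.toFinset

theorem card_derivLevelPoints_le {f : ℝ[X]} {n : ℕ} (hn : f.natDegree ≤ n) (k : ℕ) :
    (derivLevelPoints f k).card ≤ 4 * n := by
  have key (c : ℝ) : (f.derivative ^ 2 - Polynomial.C c).roots.toFinset.card ≤ 2 * n := by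
    refine (Multiset.toFinset_card_le _).trans ((Polynomial.card_roots' _).trans ?_)
    rw [Polynomial.natDegree_sub_C]
    refine Polynomial.natDegree_pow_le.trans ?_
    have := f.natDegree_derivative_le
    lia
  refine (Finset.card_union_le _ _).trans ((add_le_add (key _) (key _)).trans ?_)
  lia

/-- A piece of `[-R, R]` on which the absolute value of the derivative of `f` is in
`[2 ^ k, 2 ^ (k + 1))`. -/
def derivPiece (f : ℝ[X]) (R : ℝ) (k i : ℕ) : Set ℝ :=
  {x | x ∈ Icc (-R) R ∧ positionIn (derivLevelPoints f k) x = i ∧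
    2 ^ k ≤ |f.derivative.eval x| ∧ |f.derivative.eval x| < 2 ^ (k + 1)}

/-- Comparing `|f'|` with `2 ^ k` is a sign condition on `f' ^ 2 - (2 ^ k) ^ 2`, and likewise for `k
+ 1`. These signs cannot change between points of equal position. -/
theorem ordConnected_derivPiece (f : ℝ[X]) (R : ℝ) (k i : ℕ) : (derivPiece f R k i).OrdConnected := by
  refine ⟨fun x hx y hy z hz => ?_⟩
  have hpos : positionIn (derivLevelPoints f k) z = i :=
    le_antisymm ((monotone_positionIn _ hz.2).trans_eq hy.2.1)
      (hx.2.1.symm.trans_le (monotone_positionIn _ hz.1))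
  have heq := hx.2.1.trans hpos.symm
  have h1 := Polynomial.eval_neg_iff_of_positionIn_eq
    (Finset.subset_union_left : _ ⊆ derivLevelPoints f k) hz.1 heq
  have h2 := Polynomial.eval_neg_iff_of_positionIn_eq
    (Finset.subset_union_right : _ ⊆ derivLevelPoints f k) hz.1 heq
  simp only [Polynomial.eval_sub, Polynomial.eval_pow, Polynomial.eval_C, sub_neg, sq_lt_sq,
    abs_pow, Nat.abs_ofNat] at h1 h2
  refine ⟨⟨hx.1.1.trans hz.1, hz.2.trans hy.1.2⟩, hpos, ?_, h2.1 hx.2.2.2⟩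
  by_contra! hlt
  exact (h1.2 hlt).not_ge hx.2.2.1

theorem exists_mem_derivPiece {f : ℝ[X]} {n : ℕ} (hn : f.natDegree ≤ n) {R x : ℝ}
    (hx : x ∈ Icc (-R) R) (h : 1 ≤ |f.derivative.eval x|) :
    ∃ k, ∃ i : Fin (8 * n + 1), x ∈ derivPiece f R k i := by
  obtain ⟨k, hk1, hk2⟩ := exists_nat_pow_near h one_lt_two
  have h1 := positionIn_le (derivLevelPoints f k) x
  have h2 := card_derivLevelPoints_le hn k
  exact ⟨k, ⟨positionIn (derivLevelPoints f k) x, by lia⟩, hx, rfl, hk1, hk2⟩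

theorem pairwise_disjoint_derivPiece (f : ℝ[X]) (R : ℝ) (N : ℕ) :
    Pairwise (Function.onFun Disjoint fun p : ℕ × Fin N => derivPiece f R p.1 p.2) := by
  intro p q hpq
  refine Set.disjoint_left.2 fun x hxp hxq => hpq ?_
  have h1 : p.1 = q.1 := by
    have a := (pow_lt_pow_iff_right₀ (one_lt_two (α := ℝ))).1 (hxp.2.2.1.trans_lt hxq.2.2.2)
    have b := (pow_lt_pow_iff_right₀ (one_lt_two (α := ℝ))).1 (hxq.2.2.1.trans_lt hxp.2.2.2)
    lia
  have h2 := hxp.2.1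
  rw [h1, hxq.2.1] at h2
  exact Prod.ext h1 (Fin.ext h2.symm)

theorem abs_sub_bounds_of_mem_derivPiece {f : ℝ[X]} {R : ℝ} {k i : ℕ} {x y : ℝ}
    (hx : x ∈ derivPiece f R k i) (hy : y ∈ derivPiece f R k i) :
    2 ^ k * |x - y| ≤ |f.eval x - f.eval y| ∧ |f.eval x - f.eval y| ≤ 2 ^ (k + 1) * |x - y| := by
  wlog hlt : x < y generalizing x y
  · rcases (not_lt.1 hlt).eq_or_lt with rfl | hlt'
    · simp
    · rw [abs_sub_comm x, abs_sub_comm (f.eval x)]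
      exact this hy hx hlt'
  obtain ⟨z, hz, hzeq⟩ := exists_hasDerivAt_eq_slope (fun t => f.eval t)
    (fun t => f.derivative.eval t) hlt f.continuous.continuousOn fun t _ => f.hasDerivAt t
  have hzI := (ordConnected_derivPiece f R k i).out hx hy (Ioo_subset_Icc_self hz)
  have heq : |f.eval x - f.eval y| = |f.derivative.eval z| * |x - y| := by
    rw [abs_sub_comm x, abs_sub_comm (f.eval x), ← abs_mul]
    rw [hzeq, div_mul_cancel₀ _ (sub_ne_zero.2 hlt.ne')]
  rw [heq]
  exact ⟨by gcongr; exact hzI.2.2.1, by gcongr; exact hzI.2.2.2.le⟩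

theorem abs_sub_le_volume_real_derivPiece {f : ℝ[X]} {R : ℝ} {k i : ℕ} {x y : ℝ}
    (hx : x ∈ derivPiece f R k i) (hy : y ∈ derivPiece f R k i) :
    |x - y| ≤ MeasureTheory.volume.real (derivPiece f R k i) := by
  have hfin : MeasureTheory.volume (derivPiece f R k i) ≠ ∞ :=
    MeasureTheory.measure_ne_top_of_subset (fun z hz => hz.1) (by simp : MeasureTheory.volume (Icc (-R) R) ≠ ∞)
  have h := MeasureTheory.measureReal_mono ((ordConnected_derivPiece f R k i).uIcc_subset hx hy) hfin
  rwa [MeasureTheory.measureReal_def, Real.volume_interval, ENNReal.toReal_ofReal (abs_nonneg _),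
    abs_sub_comm] at h

/-! ### The cost of covering the points where `f` is close to an integer. -/

open MeasureTheory

/-- A set on which `f` is expanding by the factor `s` and has oscillation at most `L`: the part
where `f` is `δ`-close to an integer is covered by `2 * L + 5` balls. -/
theorem hausdorffPreOuterMeasure_close_to_int_le {g : ℝ → ℝ} {ρ s L δ : ℝ} {I : Set ℝ} {f : ℝ → ℝ}
    (hs : 0 < s) (hδ : 0 < δ) (hδ1 : δ ≤ 1) (hρ : 4 * δ / s ≤ ρ)
    (hlow : ∀ x ∈ I, ∀ y ∈ I, s * |x - y| ≤ |f x - f y|)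
    (hL : ∀ x ∈ I, ∀ y ∈ I, |f x - f y| ≤ L) :
    hausdorffPreOuterMeasure g ρ {x ∈ I | ∃ m : ℤ, |f x + m| ≤ δ} ≤
      ENNReal.ofReal (2 * L + 5) * ENNReal.ofReal (g (4 * δ / s)) := by
  rcases ({x ∈ I | ∃ m : ℤ, |f x + m| ≤ δ}).eq_empty_or_nonempty with h | ⟨x₀, hx₀, m₀, hm₀⟩
  · simp [h]
  have hL0 : 0 ≤ L := (abs_nonneg _).trans (hL x₀ hx₀ x₀ hx₀)
  have hpiece (m : ℤ) : hausdorffPreOuterMeasure g ρ {x ∈ I | |f x + m| ≤ δ} ≤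
      ENNReal.ofReal (g (4 * δ / s)) := by
    rcases ({x ∈ I | |f x + m| ≤ δ}).eq_empty_or_nonempty with h | ⟨c, hc, hcm⟩
    · simp [h]
    -- Two such points are at distance at most `2 * δ / s`; the radius `4 * δ / s` leaves room for
    -- the strict inequality of an open ball.
    refine hausdorffPreOuterMeasure_le_of_subset_ball (c := c) (by positivity) hρ ?_
    rintro x ⟨hx, hxm⟩
    rw [Metric.mem_ball, Real.dist_eq, lt_div_iff₀ hs, mul_comm]
    have h1 := hlow x hx c hc
    have h2 : |f x - f c| ≤ 2 * δ := by
      rw [abs_le] at hcm hxm ⊢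
      constructor <;> linarith
    linarith
  -- Two integers that occur differ by at most `L + 2 * δ ≤ L + 2`, and `2 * ⌊L + 2⌋ + 1 ≤ 2 * L +
  -- 5`.
  have hsub : {x ∈ I | ∃ m : ℤ, |f x + m| ≤ δ} ⊆
      ⋃ m ∈ Finset.Icc (m₀ - ⌊L + 2⌋) (m₀ + ⌊L + 2⌋), {x ∈ I | |f x + m| ≤ δ} := by
    rintro x ⟨hx, m, hm⟩
    refine mem_iUnion₂.2 ⟨m, ?_, hx, hm⟩
    have h1 := hL x hx x₀ hx₀
    rw [abs_le] at h1 hm hm₀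
    have h2 : m - m₀ ≤ ⌊L + 2⌋ := Int.le_floor.2 (by push_cast; linarith)
    have h3 : m₀ - m ≤ ⌊L + 2⌋ := Int.le_floor.2 (by push_cast; linarith)
    rw [Finset.mem_Icc]
    lia
  refine (measure_mono hsub).trans ((measure_biUnion_finset_le _ _).trans
    ((Finset.sum_le_card_nsmul _ _ _ fun m _ => hpiece m).trans ?_))
  rw [nsmul_eq_mul]
  gcongr
  have h0 : 0 ≤ ⌊L + 2⌋ := Int.floor_nonneg.2 (by linarith)
  rw [← ENNReal.ofReal_natCast]
  refine ENNReal.ofReal_le_ofReal ?_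
  have h1 : ((Finset.Icc (m₀ - ⌊L + 2⌋) (m₀ + ⌊L + 2⌋)).card : ℤ) = 2 * ⌊L + 2⌋ + 1 := by
    rw [Int.card_Icc]
    lia
  have h2 : ((Finset.Icc (m₀ - ⌊L + 2⌋) (m₀ + ⌊L + 2⌋)).card : ℝ) = 2 * ⌊L + 2⌋ + 1 := by
    exact_mod_cast h1
  rw [h2]
  linarith [Int.floor_le (L + 2)]

theorem le_div_mul_of_antitoneOn {g : ℝ → ℝ} (hg_anti : AntitoneOn (fun q => g q / q) (Ioi 0))
    {s a : ℝ} (hs : 0 < s) (hsa : s ≤ a) : g a ≤ a / s * g s := by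
  have ha := hs.trans_le hsa
  have h := hg_anti hs ha hsa
  simp only at h
  rw [div_le_iff₀ ha] at h
  exact h.trans_eq (by ring)

theorem hausdorffPreOuterMeasure_derivPiece_le {g : ℝ → ℝ} (hg : IsDimensionFunction g)
    (hg_anti : AntitoneOn (fun q => g q / q) (Ioi 0)) {ρ D δ R : ℝ} {f : ℝ[X]}
    (hδ : 0 < δ) (hδ1 : δ ≤ 1) (hρ : 4 * δ ≤ ρ) (hD : 0 < D)
    (hfD : ∀ x ∈ Icc (-R) R, |f.derivative.eval x| ≤ D) (k i : ℕ) :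
    hausdorffPreOuterMeasure g ρ {x ∈ derivPiece f R k i | ∃ m : ℤ, |f.eval x + m| ≤ δ} ≤
      ENNReal.ofReal (4 * D * g (δ / D)) * (4 * volume (derivPiece f R k i) + 5 * 2⁻¹ ^ k) := by
  have hg0 : 0 < g (δ / D) := hg.pos _ (by positivity)
  rcases (derivPiece f R k i).eq_empty_or_nonempty with h | ⟨x₀, hx₀⟩
  · simp [h]
  have hkD : (2 : ℝ) ^ k ≤ D := hx₀.2.2.1.trans (hfD x₀ hx₀.1)
  have hk1 : (1 : ℝ) ≤ 2 ^ k := one_le_pow₀ one_le_two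
  refine (hausdorffPreOuterMeasure_close_to_int_le (f := fun x => f.eval x) (s := 2 ^ k)
    (L := 2 ^ (k + 1) * volume.real (derivPiece f R k i))
    (by positivity) hδ hδ1 ((div_le_self (by positivity) hk1).trans hρ)
    (fun x hx y hy => (abs_sub_bounds_of_mem_derivPiece hx hy).1)
    (fun x hx y hy => (abs_sub_bounds_of_mem_derivPiece hx hy).2.trans
      (by gcongr; exact abs_sub_le_volume_real_derivPiece hx hy))).trans ?_
  have hfin : volume (derivPiece f R k i) ≠ ∞ :=
    measure_ne_top_of_subset (fun z hz => hz.1) (by simp : volume (Icc (-R) R) ≠ ∞)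
  have hv : volume (derivPiece f R k i) = ENNReal.ofReal (volume.real (derivPiece f R k i)) :=
    (ENNReal.ofReal_toReal hfin).symm
  set v := volume.real (derivPiece f R k i)
  have hv0 : 0 ≤ v := measureReal_nonneg
  -- Monotonicity of `g q / q` trades the scale `δ / 2 ^ k` for the common scale `δ / D`. The factor
  -- `2 ^ (-k)` gained compensates for the `2 ^ k` in the number of balls.
  have hgle : g (4 * δ / 2 ^ k) ≤ 4 * D / 2 ^ k * g (δ / D) := by
    refine (le_div_mul_of_antitoneOn hg_anti (s := δ / D) (by positivity) ?_).trans_eq ?_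
    · gcongr
      linarith
    · field_simp
  have hhalf : (2⁻¹ : ℝ≥0∞) ^ k = ENNReal.ofReal ((2 ^ k)⁻¹) := by
    rw [ENNReal.ofReal_inv_of_pos (by positivity), ENNReal.ofReal_pow (by positivity),
      ENNReal.inv_pow]
    simp
  rw [hv, hhalf, ← ENNReal.ofReal_mul (by positivity),
    show (4 : ℝ≥0∞) = ENNReal.ofReal 4 by simp, show (5 : ℝ≥0∞) = ENNReal.ofReal 5 by simp,
    ← ENNReal.ofReal_mul (by positivity), ← ENNReal.ofReal_mul (by positivity),
    ← ENNReal.ofReal_add (by positivity) (by positivity), ← ENNReal.ofReal_mul (by positivity)]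
  refine ENNReal.ofReal_le_ofReal ?_
  calc (2 * (2 ^ (k + 1) * v) + 5) * g (4 * δ / 2 ^ k)
      ≤ (2 * (2 ^ (k + 1) * v) + 5) * (4 * D / 2 ^ k * g (δ / D)) := by gcongr
    _ = 4 * D * g (δ / D) * (4 * v + 5 * (2 ^ k)⁻¹) := by
      field_simp
      ring

theorem tsum_volume_derivPiece_le (f : ℝ[X]) (R : ℝ) (N : ℕ) :
    ∑' p : ℕ × Fin N, volume (derivPiece f R p.1 p.2) ≤ ENNReal.ofReal (2 * R) := by
  have h := tsum_meas_le_meas_iUnion_of_disjoint volume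
    (fun p : ℕ × Fin N => (ordConnected_derivPiece f R p.1 p.2).measurableSet)
    (pairwise_disjoint_derivPiece f R N)
  refine h.trans ((measure_mono (iUnion_subset fun p x hx => hx.1 : _ ⊆ Icc (-R) R)).trans_eq ?_)
  rw [Real.volume_Icc]
  ring_nf

theorem tsum_inv_two_pow_fst (N : ℕ) : ∑' p : ℕ × Fin N, (2⁻¹ : ℝ≥0∞) ^ p.1 = 2 * N := by
  rw [ENNReal.tsum_prod (f := fun (k : ℕ) (_ : Fin N) => (2⁻¹ : ℝ≥0∞) ^ k)]
  simp only [tsum_fintype, Finset.sum_const, Finset.card_univ, Fintype.card_fin, nsmul_eq_mul]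
  rw [ENNReal.tsum_mul_left, ENNReal.tsum_geometric, ENNReal.one_sub_inv_two, inv_inv, mul_comm]

/-- The part of `[-R, R]` where `f` has a derivative at least `1` and is `δ`-close to an
integer. -/
theorem hausdorffPreOuterMeasure_derivative_ge_one_le {g : ℝ → ℝ} (hg : IsDimensionFunction g)
    (hg_anti : AntitoneOn (fun q => g q / q) (Ioi 0)) {ρ D δ R : ℝ} {f : ℝ[X]} {n : ℕ}
    (hn : f.natDegree ≤ n) (hδ : 0 < δ) (hδ1 : δ ≤ 1) (hρ : 4 * δ ≤ ρ) (hR : 0 ≤ R) (hD : 0 < D)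
    (hfD : ∀ x ∈ Icc (-R) R, |f.derivative.eval x| ≤ D) :
    hausdorffPreOuterMeasure g ρ {x | x ∈ Icc (-R) R ∧ 1 ≤ |f.derivative.eval x| ∧
      ∃ m : ℤ, |f.eval x + m| ≤ δ} ≤
      ENNReal.ofReal (4 * D * g (δ / D)) * ENNReal.ofReal (8 * R + 10 * (8 * n + 1)) := by
  have hsub : {x | x ∈ Icc (-R) R ∧ 1 ≤ |f.derivative.eval x| ∧ ∃ m : ℤ, |f.eval x + m| ≤ δ} ⊆
      ⋃ p : ℕ × Fin (8 * n + 1), {x ∈ derivPiece f R p.1 p.2 | ∃ m : ℤ, |f.eval x + m| ≤ δ} := by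
    rintro x ⟨hx, hx1, hm⟩
    obtain ⟨k, i, hki⟩ := exists_mem_derivPiece hn hx hx1
    exact mem_iUnion.2 ⟨(k, i), hki, hm⟩
  have h1 := measure_iUnion_le (μ := hausdorffPreOuterMeasure g ρ)
    fun p : ℕ × Fin (8 * n + 1) => {x ∈ derivPiece f R p.1 p.2 | ∃ m : ℤ, |f.eval x + m| ≤ δ}
  have h2 := ENNReal.tsum_le_tsum fun p : ℕ × Fin (8 * n + 1) =>
      hausdorffPreOuterMeasure_derivPiece_le hg hg_anti hδ hδ1 hρ hD hfD p.1 p.2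
  refine (measure_mono hsub).trans (h1.trans (h2.trans ?_))
  rw [ENNReal.tsum_mul_left, ENNReal.tsum_add, ENNReal.tsum_mul_left, ENNReal.tsum_mul_left,
    tsum_inv_two_pow_fst]
  have h10 : (10 : ℝ) * (8 * n + 1) = ((5 * (2 * (8 * n + 1)) : ℕ) : ℝ) := by push_cast; ring
  rw [h10, ENNReal.ofReal_add (by positivity) (by positivity), ENNReal.ofReal_natCast,
    show (8 : ℝ) * R = 4 * (2 * R) by ring, ENNReal.ofReal_mul (p := 4) (by positivity),
    ENNReal.ofReal_ofNat]
  refine mul_le_mul_right (add_le_add (mul_le_mul_right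
    (tsum_volume_derivPiece_le f R (8 * n + 1)) 4) (le_of_eq ?_)) _
  simp only [Nat.cast_mul, Nat.cast_ofNat]

/-! ### Covering the small-value set for all polynomials of bounded height. -/

/-- The real polynomial with constant coefficient `0` and the remaining coefficients `a`. -/
noncomputable def realPolyOfTail {n : ℕ} (a : Fin n → ℤ) : ℝ[X] :=
  (Polynomial.X * Polynomial.ofFn n a).map (Int.castRingHom ℝ)

theorem abs_coeff_realPolyOfTail_le {n : ℕ} {X : ℕ} {a : Fin n → ℤ}
    (ha : ∀ i, a i ∈ Finset.Icc (-(X : ℤ)) X) (i : ℕ) :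
    |(realPolyOfTail a).coeff i| ≤ X := by
  rw [realPolyOfTail, Polynomial.coeff_map]
  rcases i with _ | i
  · simp
  rw [Polynomial.coeff_X_mul]
  rcases lt_or_ge i n with hi | hi
  · rw [Polynomial.ofFn_coeff_eq_val_of_lt a hi]
    have := Finset.mem_Icc.1 (ha ⟨i, hi⟩)
    rw [eq_intCast, abs_le]
    exact ⟨by exact_mod_cast this.1, by exact_mod_cast this.2⟩
  · rw [Polynomial.ofFn_coeff_eq_zero_of_ge a hi]
    simp

theorem natDegree_realPolyOfTail_le {n : ℕ} (hn : 1 ≤ n) (a : Fin n → ℤ) :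
    (realPolyOfTail a).natDegree ≤ n := by
  refine Polynomial.natDegree_map_le.trans (Polynomial.natDegree_mul_le.trans ?_)
  have := Polynomial.ofFn_natDegree_lt hn a
  rw [Polynomial.natDegree_X]
  lia

theorem abs_eval_derivative_realPolyOfTail_le {n : ℕ} (hn : 1 ≤ n) {X : ℕ} {a : Fin n → ℤ}
    (ha : ∀ i, a i ∈ Finset.Icc (-(X : ℤ)) X) {R x : ℝ} (hR : 1 ≤ R) (hx : |x| ≤ R) :
    |(realPolyOfTail a).derivative.eval x| ≤
      (n + 1) * R ^ n * (n * X) := by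
  have hdeg := natDegree_realPolyOfTail_le hn a
  have hcoeff := abs_coeff_realPolyOfTail_le ha
  generalize realPolyOfTail a = f at hdeg hcoeff ⊢
  refine Polynomial.abs_eval_le_of_abs_coeff_le
    ((f.natDegree_derivative_le).trans (by lia)) (fun i => ?_) hR hx
  rw [Polynomial.coeff_derivative]
  rcases lt_or_ge n (i + 1) with hi | hi
  · rw [Polynomial.coeff_eq_zero_of_natDegree_lt (hdeg.trans_lt hi)]
    simpa using by positivity
  · rw [abs_mul, mul_comm, abs_of_nonneg (a := (i : ℝ) + 1) (by positivity)]
    gcongr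
    · exact_mod_cast hi
    · exact hcoeff _

theorem coeff_mem_Icc_of_supNorm_le {P : ℤ[X]} {X : ℕ} (hP : P.supNorm ≤ X) (i : ℕ) :
    P.coeff i ∈ Finset.Icc (-(X : ℤ)) X := by
  have h := (P.le_supNorm i).trans hP
  rw [Int.norm_eq_abs, abs_le] at h
  exact Finset.mem_Icc.2 ⟨by exact_mod_cast h.1, by exact_mod_cast h.2⟩

theorem finite_setOf_natDegree_le_supNorm_le (n X : ℕ) :
    {P : ℤ[X] | P.natDegree ≤ n ∧ P.supNorm ≤ X}.Finite := by
  refine ((Fintype.piFinset fun _ : Fin (n + 1) =>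
    Finset.Icc (-(X : ℤ)) X).finite_toSet.image (Polynomial.ofFn (n + 1))).subset ?_
  rintro P ⟨hn, hP⟩
  refine ⟨Polynomial.toFn (n + 1) P, ?_, Polynomial.ofFn_comp_toFn_eq_id_of_natDegree_lt (by lia)⟩
  exact Fintype.mem_piFinset.2 fun i => coeff_mem_Icc_of_supNorm_le hP i

/-- The points of `[-R, R]` at which some integer polynomial of degree at most `n` and height at
most `X` has a value at most `δ` and a derivative at least `1`. -/
def smallValueSet (n X : ℕ) (R δ : ℝ) : Set ℝ :=
  {x | x ∈ Icc (-R) R ∧ ∃ P : ℤ[X], P.natDegree ≤ n ∧ P.supNorm ≤ X ∧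
    |Polynomial.aeval x P| ≤ δ ∧ 1 ≤ |Polynomial.aeval x (Polynomial.derivative P)|}

theorem smallValueSet_subset {n : ℕ} (hn : 1 ≤ n) (X : ℕ) (R δ : ℝ) :
    smallValueSet n X R δ ⊆ ⋃ a ∈ Fintype.piFinset fun _ : Fin n => Finset.Icc (-(X : ℤ)) X,
      {x | x ∈ Icc (-R) R ∧
        1 ≤ |(realPolyOfTail a).derivative.eval x| ∧
        ∃ m : ℤ, |(realPolyOfTail a).eval x + m| ≤
          δ} := by
  rintro x ⟨hx, P, hPn, hPX, hP0, hP1⟩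
  have hdiv : Polynomial.ofFn n (Polynomial.toFn n P.divX) = P.divX :=
    Polynomial.ofFn_comp_toFn_eq_id_of_natDegree_lt
      (by rw [Polynomial.natDegree_divX_eq_natDegree_tsub_one]; lia)
  refine mem_iUnion₂.2 ⟨Polynomial.toFn n P.divX, Fintype.mem_piFinset.2 fun i => ?_, hx, ?_,
    P.coeff 0, ?_⟩
  · simpa [Polynomial.toFn, Polynomial.coeff_divX] using coeff_mem_Icc_of_supNorm_le hPX (i + 1)
  all_goals rw [realPolyOfTail, hdiv]
  · have h : Polynomial.derivative (Polynomial.X * P.divX) = Polynomial.derivative P := by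
      conv_rhs => rw [← P.X_mul_divX_add]
      simp
    rwa [Polynomial.derivative_map, h, Polynomial.eval_map, ← algebraMap_int_eq,
      ← Polynomial.aeval_def]
  · have h : Polynomial.aeval x P = Polynomial.aeval x (Polynomial.X * P.divX) + P.coeff 0 := by
      conv_lhs => rw [← P.X_mul_divX_add]
      simp
    rwa [Polynomial.eval_map, ← algebraMap_int_eq, ← Polynomial.aeval_def, ← h]

/-- At most `(2X + 1) ^ n ≤ (3X) ^ n` tails occur, each with derivative bounded by `D = M * X` on
`[-R, R]`. The factor `D` supplies the last power of `X`. -/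
theorem hausdorffPreOuterMeasure_smallValueSet_le {g : ℝ → ℝ} (hg : IsDimensionFunction g)
    (hg_anti : AntitoneOn (fun q => g q / q) (Ioi 0)) {ρ δ R : ℝ} {n X : ℕ} (hn : 1 ≤ n)
    (hX : 1 ≤ X) (hδ : 0 < δ) (hδ1 : δ ≤ 1) (hρ : 4 * δ ≤ ρ) (hR : 1 ≤ R) :
    hausdorffPreOuterMeasure g ρ (smallValueSet n X R δ) ≤
      ENNReal.ofReal (3 ^ n * (4 * ((n + 1) * R ^ n * n)) * (8 * R + 10 * (8 * n + 1)) *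
        (X ^ (n + 1) * g (δ / X))) := by
  have hX' : (1 : ℝ) ≤ X := by exact_mod_cast hX
  have hn' : (1 : ℝ) ≤ n := by exact_mod_cast hn
  have hM : 1 ≤ (n + 1) * R ^ n * n := one_le_mul_of_one_le_of_one_le
    (one_le_mul_of_one_le_of_one_le (by linarith) (one_le_pow₀ hR)) hn'
  set M : ℝ := (n + 1) * R ^ n * n with hMdef
  have hg0 : 0 < g (δ / X) := hg.pos _ (by positivity)
  have hgM : 0 < g (δ / (M * X)) := hg.pos _ (by positivity)
  have hgle : g (δ / (M * X)) ≤ g (δ / X) := by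
    refine hg.monotone (mem_Ioi.2 (by positivity)) (mem_Ioi.2 (by positivity)) ?_
    gcongr
    exact le_mul_of_one_le_left (by positivity) hM
  have hcard : ((Fintype.piFinset fun _ : Fin n => Finset.Icc (-(X : ℤ)) X).card : ℝ) ≤
      (3 * X) ^ n := by
    have h : (Finset.Icc (-(X : ℤ)) X).card = 2 * X + 1 := by
      rw [Int.card_Icc]
      lia
    rw [Fintype.card_piFinset, Finset.prod_const, h, Finset.card_univ, Fintype.card_fin]
    push_cast
    gcongr
    linarith
  have hpiece := fun (a : Fin n → ℤ)
      (ha : a ∈ Fintype.piFinset fun _ : Fin n => Finset.Icc (-(X : ℤ)) X) =>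
    hausdorffPreOuterMeasure_derivative_ge_one_le hg hg_anti (D := M * X) (R := R)
      (natDegree_realPolyOfTail_le hn a) hδ hδ1 hρ (by linarith) (by positivity) fun x hx =>
      (abs_eval_derivative_realPolyOfTail_le hn (Fintype.mem_piFinset.1 ha) hR
        (abs_le.2 hx)).trans_eq (by rw [hMdef]; ring)
  have hcover := (measure_mono (μ := hausdorffPreOuterMeasure g ρ)
    (smallValueSet_subset hn X R δ)).trans (measure_biUnion_finset_le _ _)
  have hsum := Finset.sum_le_card_nsmul _ _ _ hpiece
  refine hcover.trans (hsum.trans ?_)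
  rw [nsmul_eq_mul, ← ENNReal.ofReal_natCast, ← ENNReal.ofReal_mul (by positivity),
    ← ENNReal.ofReal_mul (by positivity)]
  refine ENNReal.ofReal_le_ofReal ?_
  calc _ ≤ (3 * X : ℝ) ^ n * (4 * (M * X) * g (δ / X) * (8 * R + 10 * (8 * n + 1))) := by gcongr
    _ = _ := by ring

/-! ### Condensation, Borel–Cantelli and the conclusion. -/

/-- Cauchy condensation for `G q * q ^ n`, which need not be monotone: on the block `2 ^ t < q ≤ 2 ^
(t + 1)` the factor `G` is bounded below at the right end and the power at the left end. -/
theorem summable_dyadic {G : ℝ → ℝ} (hG0 : ∀ x, 0 < x → 0 ≤ G x) (hG : AntitoneOn G (Ioi 0))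
    {n : ℕ} (hsum : Summable fun q : ℕ => G (q + 1) * ((q : ℝ) + 1) ^ n) :
    Summable fun t : ℕ => ((2 : ℝ) ^ t) ^ (n + 1) * G (2 ^ t) := by
  have hnonneg (q : ℕ) : 0 ≤ G (q + 1) * ((q : ℝ) + 1) ^ n :=
    mul_nonneg (hG0 _ (by positivity)) (by positivity)
  have hblock (t : ℕ) : ((2 : ℝ) ^ t) ^ (n + 1) * G (2 ^ (t + 1)) ≤
      ∑ q ∈ Finset.Ico (2 ^ t) (2 ^ (t + 1)), G ((q : ℕ) + 1) * ((q : ℝ) + 1) ^ n := by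
    have h := Finset.card_nsmul_le_sum (Finset.Ico (2 ^ t) (2 ^ (t + 1)))
      (fun q : ℕ => G (q + 1) * ((q : ℝ) + 1) ^ n) (G (2 ^ (t + 1)) * (2 ^ t) ^ n) fun q hq => by
        have h1 : (2 : ℝ) ^ t ≤ q := by exact_mod_cast (Finset.mem_Ico.1 hq).1
        have h2 : (q : ℝ) + 1 ≤ 2 ^ (t + 1) := by exact_mod_cast (Finset.mem_Ico.1 hq).2
        have h3 : G (2 ^ (t + 1)) ≤ G (q + 1) :=
          hG (mem_Ioi.2 (by positivity)) (mem_Ioi.2 (by positivity)) h2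
        have h4 := hG0 (q + 1) (by positivity)
        gcongr
        linarith
    refine le_trans (le_of_eq ?_) h
    rw [Nat.card_Ico, show 2 ^ (t + 1) - 2 ^ t = 2 ^ t by rw [pow_succ]; lia, nsmul_eq_mul]
    push_cast
    ring
  have hpartial (T : ℕ) : ∑ t ∈ Finset.range T, ((2 : ℝ) ^ t) ^ (n + 1) * G (2 ^ (t + 1)) ≤
      ∑ q ∈ Finset.range (2 ^ T), G ((q : ℕ) + 1) * ((q : ℝ) + 1) ^ n := by
    induction T with
    | zero => simpa using hnonneg 0
    | succ T ih =>
      rw [Finset.sum_range_succ, ← Finset.sum_range_add_sum_Ico _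
        (Nat.pow_le_pow_right two_pos T.le_succ)]
      exact add_le_add ih (hblock T)
  have hs : Summable fun t : ℕ => ((2 : ℝ) ^ t) ^ (n + 1) * G (2 ^ (t + 1)) :=
    summable_of_sum_range_le (fun t => mul_nonneg (by positivity) (hG0 _ (by positivity)))
      fun T => (hpartial T).trans (hsum.sum_le_tsum _ fun q _ => hnonneg q)
  refine (summable_nat_add_iff 1).1 ((hs.mul_left (2 ^ (n + 1))).congr fun t => ?_)
  rw [pow_succ 2 t]
  ring

/-- For small `u` one has `u ≤ g u`. With `u = ψ (2 ^ t) / 2 ^ t`, the quantity `ψ (2 ^ t) * 2 ^ t =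
(2 ^ t) ^ 2 * u` is then dominated by a term of the summable series. -/
theorem tendsto_mul_two_pow_of_summable {ψ g : ℝ → ℝ} (hψ : IsApproximationFunction ψ)
    (hg_top : Tendsto (fun q => g q / q) (𝓝[>] 0) atTop) {n : ℕ} (hn : 1 ≤ n)
    (hs : Summable fun t : ℕ => ((2 : ℝ) ^ t) ^ (n + 1) * g (ψ (2 ^ t) / 2 ^ t)) :
    Tendsto (fun t : ℕ => ψ (2 ^ t) * 2 ^ t) atTop (𝓝 0) := by
  have hpos (t : ℕ) : 0 < ψ (2 ^ t) := hψ.pos _ (by positivity)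
  have hu : Tendsto (fun t : ℕ => ψ (2 ^ t) / 2 ^ t) atTop (𝓝[>] 0) := by
    refine tendsto_nhdsWithin_iff.2 ⟨?_, .of_forall fun t => mem_Ioi.2 (div_pos (hpos t) (by positivity))⟩
    refine squeeze_zero (g := fun t : ℕ => ψ 1 / 2 ^ t)
      (fun t => (div_pos (hpos t) (by positivity)).le) (fun t => ?_) ?_
    · gcongr
      exact hψ.antitone (mem_Ioi.2 one_pos) (mem_Ioi.2 (by positivity)) (one_le_pow₀ one_le_two)
    · exact tendsto_const_nhds.div_atTop (tendsto_pow_atTop_atTop_of_one_lt one_lt_two)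
  refine squeeze_zero' (.of_forall fun t => (mul_pos (hpos t) (by positivity)).le) ?_
    hs.tendsto_atTop_zero
  filter_upwards [(hg_top.comp hu).eventually_ge_atTop 1] with t ht
  have hupos : 0 < ψ (2 ^ t) / 2 ^ t := div_pos (hpos t) (by positivity)
  have hle : ψ (2 ^ t) / 2 ^ t ≤ g (ψ (2 ^ t) / 2 ^ t) := by
    rwa [Function.comp_apply, le_div_iff₀ hupos, one_mul] at ht
  calc ψ (2 ^ t) * 2 ^ t = (2 ^ t) ^ 2 * (ψ (2 ^ t) / 2 ^ t) := by field_simp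
    _ ≤ (2 ^ t) ^ (n + 1) * g (ψ (2 ^ t) / 2 ^ t) := by
      gcongr
      · exact one_le_pow₀ one_le_two
      · lia

theorem approxSet_inter_Icc_subset {n : ℕ} (hn : 2 ≤ n) {lam κ R : ℝ}
    (hlam1 : lam < 1) (hκ : 0 < κ) (hR : 1 ≤ R) {ψ : ℝ → ℝ} (hψ : IsApproximationFunction ψ)
    (hlim : Tendsto (fun t : ℕ => ψ (2 ^ t) * 2 ^ t) atTop (𝓝 0)) :
    approxSet n lam κ ψ ∩ Icc (-R) R ⊆
      {x | ∃ᶠ t in atTop, x ∈ smallValueSet n (2 ^ (t + 1)) R (ψ (2 ^ t))} := by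
  obtain ⟨B, H₀, hB, hP⟩ :=
    exists_forall_one_le_abs_derivative_of_mem_largeDiscrPolys hn hlam1 hκ hR
  obtain ⟨T₁, hT₁⟩ := ((tendsto_pow_atTop_atTop_of_one_lt
    (one_lt_two (α := ℝ))).eventually_ge_atTop H₀).exists_forall_of_atTop
  -- The factor `2` accounts for heights up to `2 ^ (t + 1)`.
  obtain ⟨T₂, hT₂⟩ := (hlim.eventually_le_const
    (show 0 < (2 * B)⁻¹ by positivity)).exists_forall_of_atTop
  refine fun x hx => frequently_atTop.2 fun N => ?_
  -- Only finitely many polynomials have bounded degree and height, so infinitely many solutions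
  -- include arbitrarily tall ones.
  obtain ⟨P, ⟨hPD, hPx⟩, hPN⟩ := (hx.1.sdiff
    (finite_setOf_natDegree_le_supNorm_le n (2 ^ max N (max T₁ T₂)))).nonempty
  have hbig : (2 : ℝ) ^ max N (max T₁ T₂) < P.supNorm := by
    by_contra! h
    exact hPN ⟨hPD.1, by push_cast; exact h⟩
  obtain ⟨t, ht1, ht2⟩ := exists_nat_pow_near
    ((one_le_pow₀ one_le_two).trans hbig.le) (one_lt_two (α := ℝ))
  have htN : max N (max T₁ T₂) ≤ t := by
    have := (pow_lt_pow_iff_right₀ (one_lt_two (α := ℝ))).1 (hbig.trans ht2)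
    lia
  have hψle : ψ P.supNorm ≤ ψ (2 ^ t) := hψ.antitone (mem_Ioi.2 (by positivity))
    (mem_Ioi.2 (lt_of_lt_of_le (by positivity) ht1)) ht1
  refine ⟨t, by lia, hx.2, P, hPD.1, by push_cast; exact ht2.le, hPx.trans hψle, ?_⟩
  refine hP P hPD ((hT₁ t (by lia)).trans ht1) x (abs_le.2 hx.2) ?_
  have hψt := hT₂ t (by lia)
  have hsup := P.supNorm_nonneg
  have hψ0 : 0 < ψ (2 ^ t) := hψ.pos _ (by positivity)
  calc |Polynomial.aeval x P| * (B * P.supNorm)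
      ≤ ψ (2 ^ t) * (B * 2 ^ (t + 1)) := by gcongr; exact hPx.trans hψle
    _ = ψ (2 ^ t) * 2 ^ t * (2 * B) := by ring
    _ ≤ (2 * B)⁻¹ * (2 * B) := by gcongr
    _ = 1 := inv_mul_cancel₀ (by positivity)

theorem hausdorffPreOuterMeasure_frequently_smallValueSet_eq_zero {n : ℕ} (hn : 1 ≤ n) {ρ R : ℝ}
    (hρ : 0 < ρ) (hR : 1 ≤ R) {ψ g : ℝ → ℝ} (hψ : IsApproximationFunction ψ)
    (hg : IsDimensionFunction g) (hg_anti : AntitoneOn (fun q => g q / q) (Ioi 0))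
    (hs : Summable fun t : ℕ => ((2 : ℝ) ^ t) ^ (n + 1) * g (ψ (2 ^ t) / 2 ^ t))
    (hlim : Tendsto (fun t : ℕ => ψ (2 ^ t) * 2 ^ t) atTop (𝓝 0)) :
    hausdorffPreOuterMeasure g ρ
      {x | ∃ᶠ t in atTop, x ∈ smallValueSet n (2 ^ (t + 1)) R (ψ (2 ^ t))} = 0 := by
  have hpos (t : ℕ) : 0 < ψ (2 ^ t) := hψ.pos _ (by positivity)
  obtain ⟨T, hT⟩ := (hlim.eventually_le_const
    (show 0 < min 1 (ρ / 4) by positivity)).exists_forall_of_atTop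
  have hsmall (t : ℕ) (ht : T ≤ t) : ψ (2 ^ t) ≤ min 1 (ρ / 4) :=
    (le_mul_of_one_le_right (hpos t).le (one_le_pow₀ one_le_two)).trans (hT t ht)
  set C : ℝ := 3 ^ n * (4 * ((n + 1) * R ^ n * n)) * (8 * R + 10 * (8 * n + 1)) with hC
  -- The condition `T ≤ t` empties the early sets, where `δ ≤ 1` or `4 * δ ≤ ρ` might fail, so that
  -- the bound holds for every `t`.
  have hbound (t : ℕ) : hausdorffPreOuterMeasure g ρ
      {x | T ≤ t ∧ x ∈ smallValueSet n (2 ^ (t + 1)) R (ψ (2 ^ t))} ≤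
      ENNReal.ofReal (C * 2 ^ (n + 1) * ((2 ^ t) ^ (n + 1) * g (ψ (2 ^ t) / 2 ^ t))) := by
    rcases lt_or_ge t T with ht | ht
    · simp [ht.not_ge]
    have h1 := (hsmall t ht).trans (min_le_left _ _)
    have h2 := (hsmall t ht).trans (min_le_right _ _)
    have hle := hausdorffPreOuterMeasure_smallValueSet_le hg hg_anti (ρ := ρ) (n := n) hn
      (Nat.one_le_two_pow (n := t + 1)) (hpos t) h1 (by linarith) hR
    simp only [ht, true_and, ofPred_mem_eq]
    refine hle.trans (ENNReal.ofReal_le_ofReal ?_)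
    have hgle : g (ψ (2 ^ t) / (2 ^ (t + 1) : ℕ)) ≤ g (ψ (2 ^ t) / 2 ^ t) := by
      refine hg.monotone (mem_Ioi.2 (div_pos (hpos t) (by positivity)))
        (mem_Ioi.2 (div_pos (hpos t) (by positivity))) ?_
      push_cast
      have := (hpos t).le
      gcongr
      · exact one_le_two
      · lia
    calc _ ≤ C * (((2 ^ (t + 1) : ℕ) : ℝ) ^ (n + 1) * g (ψ (2 ^ t) / 2 ^ t)) := by gcongr
      _ = _ := by push_cast; ring
  have hfreq : {x | ∃ᶠ t in atTop, x ∈ smallValueSet n (2 ^ (t + 1)) R (ψ (2 ^ t))} ⊆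
      {x | ∃ᶠ t in atTop, T ≤ t ∧ x ∈ smallValueSet n (2 ^ (t + 1)) R (ψ (2 ^ t))} :=
    fun x hx => (hx.and_eventually (eventually_ge_atTop T)).mono fun t ht => ⟨ht.2, ht.1⟩
  refine measure_mono_null hfreq (measure_setOfPred_frequently_eq_zero ?_)
  exact ne_top_of_le_ne_top (hs.mul_left _).tsum_ofReal_ne_top (ENNReal.tsum_le_tsum hbound)

theorem mainTheorem1 (n : ℕ) (hn : 2 ≤ n) (lam : ℝ) (hlam0 : 0 < lam) (hlam1 : lam < 1)
    (κ : ℝ) (hκ : 0 < κ)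
    (ψ : ℝ → ℝ) (hψ : IsApproximationFunction ψ)
    (g : ℝ → ℝ) (hg : IsDimensionFunction g)
    (hg_anti : AntitoneOn (fun q => g q / q) (Ioi 0))
    (hg_top : Tendsto (fun q => g q / q) (𝓝[>] 0) atTop)
    (hsum : Summable (fun q : ℕ =>
      g (ψ ((q : ℝ) + 1) / ((q : ℝ) + 1)) * ((q : ℝ) + 1) ^ n)) :
    hausdorffGMeasure g (approxSet n lam κ ψ) = 0 := by
  have hdiv (x : ℝ) (hx : 0 < x) : 0 < ψ x / x := div_pos (hψ.pos x hx) hx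
  have hs : Summable fun t : ℕ => ((2 : ℝ) ^ t) ^ (n + 1) * g (ψ (2 ^ t) / 2 ^ t) := by
    refine summable_dyadic (G := fun x => g (ψ x / x)) (fun x hx => (hg.pos _ (hdiv x hx)).le)
      (fun x hx y hy hxy => hg.monotone (hdiv y hy) (hdiv x hx) ?_) hsum
    exact div_le_div₀ (hψ.pos x hx).le (hψ.antitone hx hy hxy) hx hxy
  have hlim := tendsto_mul_two_pow_of_summable hψ hg_top (by lia) hs
  refine hausdorffGMeasure_eq_zero_of_forall fun ρ hρ => ?_
  have hcover : approxSet n lam κ ψ ⊆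
      ⋃ R : ℕ, approxSet n lam κ ψ ∩ Icc (-((R : ℝ) + 1)) ((R : ℝ) + 1) := fun x hx => by
    obtain ⟨R, hR⟩ := exists_nat_ge |x|
    exact mem_iUnion.2 ⟨R, hx, abs_le.1 (by linarith)⟩
  refine measure_mono_null hcover (measure_iUnion_null fun R => ?_)
  have hR : (1 : ℝ) ≤ (R : ℝ) + 1 := by linarith [Nat.cast_nonneg (α := ℝ) R]
  exact measure_mono_null (approxSet_inter_Icc_subset hn hlam1 hκ hR hψ hlim)
    (hausdorffPreOuterMeasure_frequently_smallValueSet_eq_zero (by lia) hρ hR hψ hg hg_anti hs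
      hlim)
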